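/- Let $k\ge 1$ and let $\Sigma$ be a known positive definite $k\times k$ matrix; write $\|x\|_\Sigma^2=x^T\Sigma^{-1}x$. For each $n$ let $X_i\sim N_k(\theta_{0i},\Sigma)$, $i=1,\dots,n$, be independent, where the true means $\theta_{0i}=\theta_{0i}^{(n)}\in\mathbb R^k$ are sparse in the nearly-black sense: $\#\{i\le n:\theta_{0i}\ne 0\}\le q_n$ with $q_n=o(n)$. Consider the Bayesian model $X_i\mid\theta_i\sim N_k(\theta_i,\Sigma)$, $\theta_i\mid\lambda_i^2\sim N_k(0,\lambda_i^2\tau_n\Sigma)$, independently for $i=1,\dots,n$, where $\tau_n\in(0,1)$, $\tau_n\to0$ as $n\to\infty$, and the $\lambda_i^2$ are independent with probability density $\pi(u)=K u^{-a-1}\ell(u)$ on $(0,\infty)$. Here $0<a<1$, and $\ell\ge 0$ is slowly varying at infinity, non-decreasing, bounded above by a constant $M<\infty$, and bounded below by a constant $m>0$ for all large arguments. Let $0<\alpha<\beta<1$ and $\rho>0$, let $\chi^2_{k,p}$ be the upper $p$-quantile of the chi-square law with $k$ degrees of freedom, and let $L>\chi^2_{k,\alpha}(\chi^2_{k,\beta})^{-a/(1+\rho)}$.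 Let $\widehat\theta_i^R=E(\theta_i\mid X_i)$ be the posterior mean, let $\widehat r_i$ be determined by $\Pi(\|\theta_i-\widehat\theta_i^R\|_\Sigma^2\le\widehat r_i\mid X_i)=1-\alpha$, and set $$\widehat C_i^R=\{\theta\in\mathbb R^k:\ \|\theta-\widehat\theta_i^R\|_\Sigma^2\le L\,\widehat r_i^{\,a/(1+\rho)}\}.$$ Let $K_S>0$ and $\mathcal S_n=\{\theta\in\mathbb R^k:\|\theta\|_\Sigma^2\le K_S\tau_n\}$. Then there are exceptional sets $B_n\subseteq\{1,\dots,n\}$ with $\#B_n=o(n)$ such that $\theta_{0i}=0$, and hence $\theta_{0i}\in\mathcal S_n$, for all $n$ and all $i\notin B_n$, and such that for all sufficiently large $n$ and all $i\notin B_n$, $$P_{\theta_{0i}}\bigl(\theta_{0i}\in\widehat C_i^R\bigr)\ \ge\ 1-\alpha .$$ -/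

import Mathlib

open MeasureTheory ProbabilityTheory Filter Topology Set

noncomputable section

namespace GlobalLocal

/-- `ℝ^k`. -/
abbrev Vec (k : ℕ) : Type := EuclideanSpace ℝ (Fin k)

/-- The squared Mahalanobis norm `xᵀ S⁻¹ x`. -/
def mahalanobisSq {k : ℕ} (S : Matrix (Fin k) (Fin k) ℝ) (x : Vec k) : ℝ :=
  x.ofLp ⬝ᵥ (S⁻¹.mulVec x.ofLp)

/-- The Lebesgue density at `x` of the normal law `N_k(μ, S)`, for positive definite `S`. -/
def normalDensity {k : ℕ} (μ : Vec k) (S : Matrix (Fin k) (Fin k) ℝ) (x : Vec k) : ENNReal :=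
  ENNReal.ofReal ((Real.sqrt ((2 * Real.pi) ^ k * S.det))⁻¹ *
    Real.exp (-(mahalanobisSq S (x - μ)) / 2))

/-- `ℓ` is slowly varying at infinity. -/
def IsSlowlyVarying (ℓ : ℝ → ℝ) : Prop :=
  ∀ t : ℝ, 0 < t → Tendsto (fun u => ℓ (t * u) / ℓ u) atTop (𝓝 1)

/-- The prior law of a local parameter `λ²`: the measure on `(0, ∞)` with density
`K u^(-a-1) ℓ(u)`. -/
def localPrior (a K : ℝ) (ℓ : ℝ → ℝ) : Measure ℝ :=
  (volume.restrict (Ioi 0)).withDensity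
    (fun u => ENNReal.ofReal (K * u ^ (-a - 1) * ℓ u))

/-- The prior law of a mean vector `θ`, where `θ | λ² ∼ N_k(0, λ² τ S)` and `λ²` has the law
`localPrior a K ℓ`: the mixture of these normal laws, written through its density. -/
def meanPrior {k : ℕ} (S : Matrix (Fin k) (Fin k) ℝ) (a K : ℝ) (ℓ : ℝ → ℝ) (τ : ℝ) :
    Measure (Vec k) :=
  volume.withDensity
    (fun θ => ∫⁻ u, normalDensity 0 ((u * τ) • S) θ ∂(localPrior a K ℓ))

/-- The posterior law `Π(· | X = x)` of `θ` when `X | θ ∼ N_k(θ, S)` and `θ` has the law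
`meanPrior S a K ℓ τ`, given by Bayes' formula. -/
def posteriorLaw {k : ℕ} (S : Matrix (Fin k) (Fin k) ℝ) (a K : ℝ) (ℓ : ℝ → ℝ) (τ : ℝ)
    (x : Vec k) : Measure (Vec k) :=
  (∫⁻ θ, normalDensity θ S x ∂(meanPrior S a K ℓ τ))⁻¹ •
    (meanPrior S a K ℓ τ).withDensity (fun θ => normalDensity θ S x)

/-- The posterior mean `E(θ | X = x)`. -/
def posteriorMean {k : ℕ} (S : Matrix (Fin k) (Fin k) ℝ) (a K : ℝ) (ℓ : ℝ → ℝ) (τ : ℝ)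
    (x : Vec k) : Vec k :=
  ∫ θ, θ ∂(posteriorLaw S a K ℓ τ x)

/-- The posterior `(1 - α)`-quantile of the squared distance `‖θ - E(θ | X = x)‖_S²`. The posterior
law of this distance has no atoms and has full support on `[0, ∞)`, so this is the unique `r` with
`Π(‖θ - E(θ | X = x)‖_S² ≤ r | X = x) = 1 - α`. -/
def credibleRadius {k : ℕ} (S : Matrix (Fin k) (Fin k) ℝ) (a K : ℝ) (ℓ : ℝ → ℝ) (τ α : ℝ)
    (x : Vec k) : ℝ :=
  sInf {r : ℝ | 1 - α ≤ (posteriorLaw S a K ℓ τ x).real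
    {θ | mahalanobisSq S (θ - posteriorMean S a K ℓ τ x) ≤ r}}

/-- The credible set `{θ : ‖θ - E(θ | X = x)‖_S² ≤ L r^(a/(1+ρ))}`, with `r` the posterior
`(1 - α)`-quantile of the squared distance. -/
def credibleSet {k : ℕ} (S : Matrix (Fin k) (Fin k) ℝ) (a K : ℝ) (ℓ : ℝ → ℝ) (τ α ρ L : ℝ)
    (x : Vec k) : Set (Vec k) :=
  {θ | mahalanobisSq S (θ - posteriorMean S a K ℓ τ x) ≤
    L * credibleRadius S a K ℓ τ α x ^ (a / (1 + ρ))}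

/-- The chi-square law with `k` degrees of freedom: the law of `‖Z‖²` for `Z` standard normal
in `ℝ^k`. -/
def chiSquareLaw (k : ℕ) : Measure ℝ :=
  (stdGaussian (Vec k)).map (fun z => ‖z‖ ^ 2)

/-- The upper `p`-quantile `χ²_{k,p}`: a chi-square variable exceeds it with probability `p`. -/
def chiSquareQuantile (k : ℕ) (p : ℝ) : ℝ :=
  sInf {t : ℝ | 0 ≤ t ∧ (chiSquareLaw k).real (Ioi t) ≤ p}

/-- The set `𝒮` of small mean vectors. -/
def smallMeans {k : ℕ} (S : Matrix (Fin k) (Fin k) ℝ) (KS τ : ℝ) : Set (Vec k) :=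
  {θ | mahalanobisSq S θ ≤ KS * τ}

/-- The families of `n` mean vectors of which at most `q` are non-zero. -/
def nearlyBlack (k n q : ℕ) : Set (Fin n → Vec k) :=
  {θ | {i | θ i ≠ 0}.ncard ≤ q}

/-- The joint law of independent `X_i ∼ N_k(θ_i, S)`, `i = 1, …, n`. -/
def dataLaw {k n : ℕ} (S : Matrix (Fin k) (Fin k) ℝ) (θ : Fin n → Vec k) :
    Measure (Fin n → Vec k) :=
  Measure.pi (fun i => multivariateGaussian (θ i) S)

end GlobalLocal

end

/-! Take the exceptional set to be the support of the true means, which sparsity makes `o(n)`. Off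
it every observation is `N_k(0, Σ)`, so one radius `R`, independent of `n`, satisfies `‖X_i‖ ≤ R`
with probability at least `1 - α`. It remains to show that for small `τ` every such observation
yields a credible set containing the origin.

On this ball the marginal density is bounded below uniformly in `τ`
(`exists_le_lintegral_normalDensity_meanPrior`), so the posterior is at most a constant times the
prior, and two prior estimates suffice. The prior charges balls of squared radius `cτ` very little,
wherever they are centred, so the credible radius is at least `cτ` (`exists_le_credibleRadius`). The
prior moment of order `a` is of order `τ^(a/2)`, so the posterior mean has squared norm `O(τ^a)`
(`exists_norm_posteriorMean_le`). Since `a/(1+ρ) < a`, the inflated radius, at least of order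
`τ^(a/(1+ρ))`, eventually dominates `τ^a`. -/

namespace GlobalLocal

variable {k : ℕ} {S : Matrix (Fin k) (Fin k) ℝ}

/-! ### The Mahalanobis form -/

theorem mahalanobisSq_zero : mahalanobisSq S 0 = 0 := by
  simp [mahalanobisSq]

theorem mahalanobisSq_neg (x : Vec k) : mahalanobisSq S (-x) = mahalanobisSq S x := by
  simp [mahalanobisSq, Matrix.mulVec_neg]

theorem mahalanobisSq_smul (t : ℝ) (x : Vec k) :
    mahalanobisSq S (t • x) = t ^ 2 * mahalanobisSq S x := by
  simp [mahalanobisSq, Matrix.mulVec_smul]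
  ring

/-- No invertibility is needed: for `v = 0` or singular `S` both sides vanish, the inverses being
`0` by convention. -/
theorem mahalanobisSq_smul_matrix (v : ℝ) (x : Vec k) :
    mahalanobisSq (v • S) x = v⁻¹ * mahalanobisSq S x := by
  rcases eq_or_ne v 0 with rfl | hv
  · rcases isEmpty_or_nonempty (Fin k) with h | h
    · simp [mahalanobisSq, dotProduct]
    · simp [mahalanobisSq]
  · by_cases hS : IsUnit S.det
    · have := Matrix.inv_smul' (A := S) (Units.mk0 v hv) hS
      have h2 : (v • S)⁻¹ = v⁻¹ • S⁻¹ := by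
        simpa [Units.smul_def] using this
      simp [mahalanobisSq, h2, Matrix.smul_mulVec]
    · have h1 : ¬ IsUnit (v • S).det := by
        rw [Matrix.det_smul]
        intro h
        exact hS (isUnit_of_mul_isUnit_right h)
      simp [mahalanobisSq, Matrix.nonsing_inv_apply_not_isUnit _ h1,
        Matrix.nonsing_inv_apply_not_isUnit _ hS]

theorem continuous_mahalanobisSq : Continuous (mahalanobisSq S) := by
  unfold mahalanobisSq
  fun_prop

/-- The Mahalanobis norm is equivalent to the Euclidean norm. -/
theorem exists_norm_sq_equiv (hS : S.PosDef) :
    ∃ c C : ℝ, 0 < c ∧ 0 < C ∧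
      ∀ x : Vec k, c * ‖x‖ ^ 2 ≤ mahalanobisSq S x ∧ mahalanobisSq S x ≤ C * ‖x‖ ^ 2 := by
  rcases isEmpty_or_nonempty (Fin k) with h | h
  · refine ⟨1, 1, one_pos, one_pos, fun x => ?_⟩
    have : x = 0 := Subsingleton.elim _ _
    simp [this, mahalanobisSq_zero]
  have hne : (Metric.sphere (0 : Vec k) 1).Nonempty := NormedSpace.sphere_nonempty.2 zero_le_one
  have hcpt := isCompact_sphere (0 : Vec k) 1
  obtain ⟨y, hy, hmin⟩ := hcpt.exists_isMinOn hne continuous_mahalanobisSq.continuousOn (f := mahalanobisSq S)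
  obtain ⟨z, hz, hmax⟩ := hcpt.exists_isMaxOn hne continuous_mahalanobisSq.continuousOn (f := mahalanobisSq S)
  have hpos : ∀ w ∈ Metric.sphere (0 : Vec k) 1, 0 < mahalanobisSq S w := by
    intro w hw
    have hw0 : w.ofLp ≠ 0 := by
      intro h0
      have : w = 0 := by ext i; simp [h0]
      simp [this] at hw
    simpa [mahalanobisSq] using hS.inv.dotProduct_mulVec_pos hw0
  refine ⟨mahalanobisSq S y, mahalanobisSq S z, hpos y hy, hpos z hz, fun x => ?_⟩
  rcases eq_or_ne x 0 with rfl | hx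
  · simp [mahalanobisSq_zero]
  have hx' : ‖x‖ ≠ 0 := norm_ne_zero_iff.2 hx
  have hmem : ‖x‖⁻¹ • x ∈ Metric.sphere (0 : Vec k) 1 := by
    simp [norm_smul, hx']
  have hxe : mahalanobisSq S x = mahalanobisSq S (‖x‖⁻¹ • x) * ‖x‖ ^ 2 := by
    rw [mahalanobisSq_smul]; field_simp
  rw [hxe]
  exact ⟨mul_le_mul_of_nonneg_right (hmin hmem) (sq_nonneg _),
    mul_le_mul_of_nonneg_right (hmax hmem) (sq_nonneg _)⟩

/-! ### Bounds, scaling and moments of normal densities -/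

/-- The normalizing constant of a centred normal density. -/
noncomputable def normalConst (S : Matrix (Fin k) (Fin k) ℝ) : ℝ :=
  (Real.sqrt ((2 * Real.pi) ^ k * S.det))⁻¹

theorem normalConst_pos (hS : S.PosDef) : 0 < normalConst S := by
  have := hS.det_pos
  unfold normalConst
  positivity

theorem normalDensity_eq (μ x : Vec k) : normalDensity μ S x =
    ENNReal.ofReal (normalConst S * Real.exp (-(mahalanobisSq S (x - μ)) / 2)) := rfl

theorem measurable_normalDensity (μ : Vec k) : Measurable (normalDensity μ S) := by
  have := continuous_mahalanobisSq (S := S)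
  unfold normalDensity
  fun_prop

theorem measurable_normalDensity_mean (x : Vec k) :
    Measurable (fun μ => normalDensity μ S x) := by
  have := continuous_mahalanobisSq (S := S)
  unfold normalDensity
  fun_prop

theorem normalDensity_le (hS : S.PosDef) (μ x : Vec k) :
    normalDensity μ S x ≤ ENNReal.ofReal (normalConst S) := by
  obtain ⟨c, C, hc, -, h⟩ := exists_norm_sq_equiv hS
  rw [normalDensity_eq]
  refine ENNReal.ofReal_le_ofReal (mul_le_of_le_one_right (normalConst_pos hS).le ?_)
  rw [Real.exp_le_one_iff]
  have := (h (x - μ)).1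
  have : 0 ≤ c * ‖x - μ‖ ^ 2 := by positivity
  linarith

theorem exists_le_normalDensity (hS : S.PosDef) (r : ℝ) : ∃ d : ENNReal, 0 < d ∧
    ∀ μ x : Vec k, ‖x - μ‖ ≤ r → d ≤ normalDensity μ S x := by
  obtain ⟨c, C, -, hC, h⟩ := exists_norm_sq_equiv hS
  have hK := normalConst_pos hS
  refine ⟨ENNReal.ofReal (normalConst S * Real.exp (-(C * r ^ 2) / 2)),
    ENNReal.ofReal_pos.2 (by positivity), fun μ x hr => ?_⟩
  rw [normalDensity_eq]
  have h1 := (h (x - μ)).2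
  have h2 : C * ‖x - μ‖ ^ 2 ≤ C * r ^ 2 := by gcongr
  refine ENNReal.ofReal_le_ofReal ?_
  gcongr
  linarith

theorem normalDensity_smul {v : ℝ} (hv : 0 < v) (θ : Vec k) :
    normalDensity 0 (v • S) θ =
      ENNReal.ofReal ((Real.sqrt v ^ k)⁻¹) * normalDensity 0 S ((Real.sqrt v)⁻¹ • θ) := by
  rw [normalDensity_eq, normalDensity_eq, ← ENNReal.ofReal_mul (by positivity), ← mul_assoc,
    sub_zero, sub_zero, mahalanobisSq_smul_matrix, mahalanobisSq_smul, inv_pow,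
    Real.sq_sqrt hv.le]
  congr 2
  rw [normalConst, normalConst, Matrix.det_smul, Fintype.card_fin, mul_left_comm,
    Real.sqrt_mul (by positivity), mul_inv]
  congr 2
  rw [Real.sqrt_eq_iff_mul_self_eq_of_pos (by positivity), ← mul_pow, Real.mul_self_sqrt hv.le]

/-- Integration against a rescaled centred normal density. -/
theorem lintegral_normalDensity_smul {v : ℝ} (hv : 0 < v) {f : Vec k → ENNReal}
    (hf : Measurable f) :
    ∫⁻ θ, normalDensity 0 (v • S) θ * f θ =
      ∫⁻ z, normalDensity 0 S z * f (Real.sqrt v • z) := by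
  have hs : 0 < Real.sqrt v := Real.sqrt_pos.2 hv
  have hmeas : Measurable (fun z => normalDensity 0 S z * f (Real.sqrt v • z)) :=
    (measurable_normalDensity 0).mul (hf.comp (measurable_const_smul _))
  calc ∫⁻ θ, normalDensity 0 (v • S) θ * f θ
      = ∫⁻ θ, ENNReal.ofReal ((Real.sqrt v ^ k)⁻¹) *
        (fun z => normalDensity 0 S z * f (Real.sqrt v • z)) ((Real.sqrt v)⁻¹ • θ) := by
        simp only [normalDensity_smul hv, smul_smul, mul_inv_cancel₀ hs.ne', one_smul, mul_assoc]
    _ = ∫⁻ z, normalDensity 0 S z * f (Real.sqrt v • z) := by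
      rw [lintegral_const_mul' _ _ ENNReal.ofReal_ne_top,
        ← lintegral_map hmeas (measurable_const_smul _),
        Measure.map_addHaar_smul _ (inv_ne_zero hs.ne'), lintegral_smul_measure, smul_eq_mul,
        ← mul_assoc, ← ENNReal.ofReal_mul (by positivity)]
      simp only [finrank_euclideanSpace, Fintype.card_fin, inv_pow, inv_inv]
      rw [abs_of_pos (by positivity), inv_mul_cancel₀ (by positivity), ENNReal.ofReal_one,
        one_mul]

/-- Gaussian domination of the normal density times a linearly growing factor. -/
theorem exists_normalDensity_mul_le (hS : S.PosDef) : ∃ c D : ℝ, 0 < c ∧ 0 < D ∧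
    ∀ μ x : Vec k, normalDensity μ S x * ENNReal.ofReal (1 + ‖x - μ‖) ≤
      ENNReal.ofReal (D * Real.exp (-c * ‖x - μ‖ ^ 2)) := by
  obtain ⟨c₀, C, hc, -, h⟩ := exists_norm_sq_equiv hS
  have hK := normalConst_pos hS
  refine ⟨c₀ / 4, normalConst S * (2 + (c₀ / 4)⁻¹), by positivity, by positivity, fun μ x => ?_⟩
  rw [normalDensity_eq, ← ENNReal.ofReal_mul (by positivity)]
  refine ENNReal.ofReal_le_ofReal ?_
  have h1 := (h (x - μ)).1
  set t := ‖x - μ‖ with ht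
  have ht0 : 0 ≤ t := norm_nonneg _
  have hexp : Real.exp (-(mahalanobisSq S (x - μ)) / 2) ≤
      Real.exp (-(c₀ / 4) * t ^ 2) * Real.exp (-(c₀ / 4 * t ^ 2)) := by
    rw [← Real.exp_add, Real.exp_le_exp]; linarith
  -- Half of the Gaussian exponent is spent on absorbing the linear factor.
  have hlin : 1 + t ≤ (2 + (c₀ / 4)⁻¹) * Real.exp (c₀ / 4 * t ^ 2) := by
    have h2 := Real.add_one_le_exp (c₀ / 4 * t ^ 2)
    have h3 : (2 + (c₀ / 4)⁻¹) * (c₀ / 4 * t ^ 2 + 1) =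
        2 + (c₀ / 4)⁻¹ + 2 * (c₀ / 4 * t ^ 2) + t ^ 2 := by field_simp; ring
    have h4 : 0 < (c₀ / 4)⁻¹ := by positivity
    have h5 : 0 ≤ c₀ / 4 * t ^ 2 := by positivity
    calc 1 + t ≤ (2 + (c₀ / 4)⁻¹) * (c₀ / 4 * t ^ 2 + 1) := by
          rw [h3]; nlinarith [sq_nonneg (t - 1)]
      _ ≤ _ := by gcongr
  calc normalConst S * Real.exp (-(mahalanobisSq S (x - μ)) / 2) * (1 + t)
      ≤ normalConst S * (Real.exp (-(c₀ / 4) * t ^ 2) * Real.exp (-(c₀ / 4 * t ^ 2))) *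
        ((2 + (c₀ / 4)⁻¹) * Real.exp (c₀ / 4 * t ^ 2)) := by gcongr
    _ = _ := by
      have : Real.exp (-(c₀ / 4 * t ^ 2)) * Real.exp (c₀ / 4 * t ^ 2) = 1 := by
        rw [← Real.exp_add]; simp
      linear_combination (normalConst S * Real.exp (-(c₀ / 4) * t ^ 2) * (2 + (c₀ / 4)⁻¹)) * this

theorem lintegral_exp_neg_mul_norm_sq_lt_top {c : ℝ} (hc : 0 < c) (D : ℝ) :
    ∫⁻ z : Vec k, ENNReal.ofReal (D * Real.exp (-c * ‖z‖ ^ 2)) < ⊤ := by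
  have h := GaussianFourier.integrable_cexp_neg_mul_sq_norm_add (V := Vec k) (b := (c : ℂ))
    (by simpa using hc) 0 0
  have h2 : Integrable (fun z : Vec k => Real.exp (-c * ‖z‖ ^ 2)) := by
    refine h.norm.congr (Eventually.of_forall fun z => ?_)
    simp only [Complex.norm_exp]
    congr 1
    simp [← Complex.ofReal_pow, ← Complex.ofReal_mul]
  exact (h2.const_mul D).lintegral_lt_top

/-- A normal vector has finite moments of order at most one. -/
theorem lintegral_normalDensity_mul_rpow_lt_top (hS : S.PosDef) {a : ℝ} (ha0 : 0 ≤ a)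
    (ha1 : a ≤ 1) : ∫⁻ z, normalDensity 0 S z * ‖z‖ₑ ^ a < ⊤ := by
  obtain ⟨c, D, hc, -, h⟩ := exists_normalDensity_mul_le hS
  refine lt_of_le_of_lt (lintegral_mono fun z => ?_)
    (lintegral_exp_neg_mul_norm_sq_lt_top (k := k) hc D)
  refine le_trans ?_ (by simpa using h 0 z)
  gcongr
  rw [← ofReal_norm, ENNReal.ofReal_rpow_of_nonneg (norm_nonneg _) ha0]
  refine ENNReal.ofReal_le_ofReal ?_
  rcases le_total ‖z‖ 1 with h1 | h1
  · linarith [Real.rpow_le_one (norm_nonneg z) h1 ha0, norm_nonneg z]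
  · linarith [(Real.rpow_le_rpow_of_exponent_le h1 ha1).trans_eq (Real.rpow_one _)]

/-- The moment of order zero; finiteness suffices below, and the exact value is never needed. -/
theorem lintegral_normalDensity_lt_top (hS : S.PosDef) :
    ∫⁻ z, normalDensity 0 S z < ⊤ := by
  simpa using lintegral_normalDensity_mul_rpow_lt_top hS le_rfl zero_le_one

/-! ### The priors of the local parameter and of the mean vector -/

variable {a K : ℝ} {ℓ : ℝ → ℝ} {τ : ℝ}

theorem ae_pos_localPrior : ∀ᵐ u ∂localPrior a K ℓ, 0 < u :=
  (withDensity_absolutelyContinuous _ _).ae_le (ae_restrict_mem measurableSet_Ioi)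

/-- The local prior has moments of every order below its tail index. -/
theorem lintegral_rpow_localPrior_lt_top [IsFiniteMeasure (localPrior a K ℓ)] {M s : ℝ}
    (hs0 : 0 ≤ s) (hsa : s < a) (hnonneg : ∀ u : ℝ, 0 < u → 0 ≤ ℓ u)
    (hupper : ∀ u : ℝ, 0 < u → ℓ u ≤ M) :
    ∫⁻ u, ENNReal.ofReal u ^ s ∂localPrior a K ℓ < ⊤ := by
  have hM : 0 ≤ M := (hnonneg 1 one_pos).trans (hupper 1 one_pos)
  have hle : localPrior a K ℓ ≤ (volume.restrict (Ioi 0)).withDensity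
      (fun u => ENNReal.ofReal (|K| * M * u ^ (-a - 1))) := by
    refine withDensity_mono ?_
    filter_upwards [ae_restrict_mem measurableSet_Ioi] with u hu
    have hu' : 0 < u := hu
    refine ENNReal.ofReal_le_ofReal ?_
    have h1 : 0 ≤ u ^ (-a - 1) := by positivity
    calc K * u ^ (-a - 1) * ℓ u ≤ |K| * u ^ (-a - 1) * ℓ u := by
          gcongr
          · exact hnonneg u hu'
          · exact le_abs_self K
      _ ≤ |K| * u ^ (-a - 1) * M := by gcongr; exact hupper u hu'
      _ = _ := by ring
  -- Below `1` the integrand is at most `1` and the total mass is finite; above `1` the boundedness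
  -- of `ℓ` leaves the tail `u^(s-a-1)`, integrable because `s < a`.
  rw [← lintegral_add_compl _ (measurableSet_Iic (a := (1 : ℝ))), compl_Iic]
  refine ENNReal.add_lt_top.2 ⟨?_, ?_⟩
  · calc ∫⁻ u in Iic 1, ENNReal.ofReal u ^ s ∂localPrior a K ℓ
        ≤ ∫⁻ u in Iic 1, 1 ∂localPrior a K ℓ := by
          refine setLIntegral_mono measurable_const fun u hu => ?_
          exact ENNReal.rpow_le_one (ENNReal.ofReal_le_one.2 hu) hs0
      _ < ⊤ := by simp
  · have hmeas : Measurable fun u : ℝ => ENNReal.ofReal (|K| * M * u ^ (-a - 1)) := by fun_prop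
    calc ∫⁻ u in Ioi 1, ENNReal.ofReal u ^ s ∂localPrior a K ℓ
        ≤ ∫⁻ u in Ioi 1, ENNReal.ofReal u ^ s ∂((volume.restrict (Ioi 0)).withDensity
            (fun u => ENNReal.ofReal (|K| * M * u ^ (-a - 1)))) :=
          lintegral_mono' (Measure.restrict_mono le_rfl hle) le_rfl
      _ = ∫⁻ u in Ioi 1, ENNReal.ofReal (|K| * M * u ^ (-a - 1)) * ENNReal.ofReal u ^ s := by
          rw [restrict_withDensity measurableSet_Ioi,
            lintegral_withDensity_eq_lintegral_mul _ hmeas (by fun_prop),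
            Measure.restrict_restrict measurableSet_Ioi,
            inter_eq_left.2 (Ioi_subset_Ioi zero_le_one)]
          rfl
      _ = ∫⁻ u in Ioi 1, ENNReal.ofReal (|K| * M * u ^ (s - a - 1)) := by
          refine setLIntegral_congr_fun measurableSet_Ioi fun u hu => ?_
          have hu' : 0 < u := zero_lt_one.trans hu
          rw [ENNReal.ofReal_rpow_of_pos hu', ← ENNReal.ofReal_mul (by positivity), mul_assoc,
            ← Real.rpow_add hu']
          ring_nf
      _ < ⊤ := ((integrableOn_Ioi_rpow_of_lt (by linarith) one_pos).const_mul _).lintegral_lt_top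

/-- Pulling the scalar out of the determinant and the inverse makes the dependence on `u` explicit.
-/
theorem measurable_normalDensity_smul_uncurry :
    Measurable (fun p : ℝ × Vec k => normalDensity 0 ((p.1 * τ) • S) p.2) := by
  have := continuous_mahalanobisSq (S := S)
  simp only [normalDensity, Matrix.det_smul, mahalanobisSq_smul_matrix, sub_zero]
  fun_prop

/-- Integration against the prior of a mean vector, conditionally on the local parameter. -/
theorem lintegral_meanPrior [SFinite (localPrior a K ℓ)] (hτ : 0 < τ) {f : Vec k → ENNReal}
    (hf : Measurable f) :
    ∫⁻ θ, f θ ∂meanPrior S a K ℓ τ =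
      ∫⁻ u, (∫⁻ z, normalDensity 0 S z * f (Real.sqrt (u * τ) • z)) ∂localPrior a K ℓ := by
  have hm := measurable_normalDensity_smul_uncurry (k := k) (S := S) (τ := τ)
  rw [meanPrior, lintegral_withDensity_eq_lintegral_mul _ hm.lintegral_prod_left' hf]
  calc ∫⁻ θ, (∫⁻ u, normalDensity 0 ((u * τ) • S) θ ∂localPrior a K ℓ) * f θ
      = ∫⁻ θ, ∫⁻ u, normalDensity 0 ((u * τ) • S) θ * f θ ∂localPrior a K ℓ := by
        refine lintegral_congr fun θ => ?_
        exact (lintegral_mul_const _ (hm.comp measurable_prodMk_right)).symm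
    _ = ∫⁻ u, (∫⁻ θ, normalDensity 0 ((u * τ) • S) θ * f θ) ∂localPrior a K ℓ := by
        rw [lintegral_lintegral_swap]
        exact ((hm.comp measurable_swap).mul (hf.comp measurable_fst)).aemeasurable
    _ = _ := by
        refine lintegral_congr_ae ?_
        filter_upwards [ae_pos_localPrior] with u hu
        exact lintegral_normalDensity_smul (mul_pos hu hτ) hf

theorem isFiniteMeasure_meanPrior [IsFiniteMeasure (localPrior a K ℓ)] (hS : S.PosDef)
    (hτ : 0 < τ) : IsFiniteMeasure (meanPrior S a K ℓ τ) := by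
  refine ⟨?_⟩
  have := lintegral_meanPrior (S := S) (a := a) (K := K) (ℓ := ℓ) hτ
    (measurable_const (a := (1 : ENNReal)))
  simp only [lintegral_const, one_mul, mul_one] at this
  rw [this]
  exact ENNReal.mul_lt_top (lintegral_normalDensity_lt_top hS) (measure_lt_top _ _)

/-- The moment of order `a` of the mean prior scales like `τ ^ (a / 2)`. -/
theorem exists_lintegral_rpow_meanPrior_eq [IsFiniteMeasure (localPrior a K ℓ)] {M : ℝ}
    (hS : S.PosDef) (ha0 : 0 < a) (ha1 : a ≤ 1) (hnonneg : ∀ u : ℝ, 0 < u → 0 ≤ ℓ u)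
    (hupper : ∀ u : ℝ, 0 < u → ℓ u ≤ M) : ∃ A : ENNReal, A < ⊤ ∧ ∀ τ : ℝ, 0 < τ →
      ∫⁻ θ, ‖θ‖ₑ ^ a ∂meanPrior S a K ℓ τ = A * ENNReal.ofReal (τ ^ (a / 2)) := by
  refine ⟨(∫⁻ u, ENNReal.ofReal u ^ (a / 2) ∂localPrior a K ℓ) *
    ∫⁻ z, normalDensity 0 S z * ‖z‖ₑ ^ a, ENNReal.mul_lt_top
      (lintegral_rpow_localPrior_lt_top (by positivity) (by linarith) hnonneg hupper)
      (lintegral_normalDensity_mul_rpow_lt_top hS ha0.le ha1), fun τ hτ => ?_⟩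
  have hz : Measurable fun z : Vec k => normalDensity 0 S z * ‖z‖ₑ ^ a :=
    (measurable_normalDensity 0).mul (by fun_prop)
  rw [lintegral_meanPrior hτ (by fun_prop), mul_assoc,
    ← lintegral_mul_const _ (by fun_prop)]
  refine lintegral_congr_ae ?_
  filter_upwards [ae_pos_localPrior] with u hu
  rw [mul_comm (∫⁻ z, normalDensity 0 S z * ‖z‖ₑ ^ a), ← mul_assoc, ← lintegral_const_mul _ hz]
  refine lintegral_congr fun z => ?_
  rw [enorm_smul, ENNReal.mul_rpow_of_nonneg _ _ ha0.le, mul_left_comm]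
  congr 1
  rw [Real.enorm_of_nonneg (Real.sqrt_nonneg _), ENNReal.ofReal_rpow_of_nonneg (Real.sqrt_nonneg _)
    ha0.le, ENNReal.ofReal_rpow_of_pos hu, ← ENNReal.ofReal_mul (by positivity),
    ← Real.mul_rpow hu.le hτ.le, Real.sqrt_eq_rpow, ← Real.rpow_mul (by positivity)]
  ring_nf

/-- The mean prior gives little mass to balls of squared radius small compared to `τ`. -/
theorem exists_meanPrior_ball_le [IsProbabilityMeasure (localPrior a K ℓ)] (hk : 1 ≤ k)
    (hS : S.PosDef) {η : ENNReal} (hη : 0 < η) : ∃ c : ℝ, 0 < c ∧ ∀ τ : ℝ, 0 < τ →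
      ∀ b : Vec k, meanPrior S a K ℓ τ {θ | mahalanobisSq S (θ - b) ≤ c * τ} ≤ η := by
  obtain ⟨c₁, C₁, hc₁, -, hQ⟩ := exists_norm_sq_equiv hS
  have hη2 : 0 < η / 2 := ENNReal.half_pos hη.ne'
  have hN := lintegral_normalDensity_lt_top hS
  set N := ∫⁻ z, normalDensity 0 S z with hNdef
  -- The local prior has no mass at `0`, so scales `u ≤ ε` contribute little.
  obtain ⟨ε, hε, hε0⟩ : ∃ ε : ℝ, N * localPrior a K ℓ (Iic ε) < η / 2 ∧ 0 < ε := by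
    have h0 : localPrior a K ℓ (⋂ r > (0 : ℝ), Iic r) = 0 := by
      rw [measure_eq_zero_iff_ae_notMem]
      filter_upwards [ae_pos_localPrior] with u hu hmem
      simp only [mem_iInter, mem_Iic] at hmem
      linarith [hmem (u / 2) (half_pos hu)]
    have ht := tendsto_measure_biInter_gt (μ := localPrior a K ℓ) (s := fun r : ℝ => Iic r)
      (a := 0) (fun r _ => measurableSet_Iic.nullMeasurableSet)
      (fun i j _ hij => Iic_subset_Iic.2 hij) ⟨1, one_pos, measure_ne_top _ _⟩
    rw [h0] at ht
    have ht' := ENNReal.Tendsto.const_mul ht (Or.inr hN.ne) (a := N)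
    rw [mul_zero] at ht'
    exact ((ht'.eventually (gt_mem_nhds hη2)).and self_mem_nhdsWithin).exists
  -- Bounded density makes small balls light, uniformly in the centre; `k ≥ 1` is what sends `δ^k`
  -- to `0`.
  obtain ⟨δ, hδ, hδ0⟩ : ∃ δ : ℝ, (∀ b : Vec k, ENNReal.ofReal (normalConst S) *
      volume (Metric.closedBall b δ) < η / 2) ∧ 0 < δ := by
    have ht : Tendsto (fun δ : ℝ => ENNReal.ofReal (normalConst S) *
        (ENNReal.ofReal (δ ^ k) * volume (Metric.ball (0 : Vec k) 1))) (𝓝[>] 0) (𝓝 0) := by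
      have h1 : Tendsto (fun δ : ℝ => ENNReal.ofReal (δ ^ k)) (𝓝[>] 0) (𝓝 0) := by
        have : Tendsto (fun δ : ℝ => ENNReal.ofReal (δ ^ k)) (𝓝 0)
            (𝓝 (ENNReal.ofReal (0 ^ k))) := by
          exact (ENNReal.continuous_ofReal.comp (continuous_pow k)).tendsto 0
        rw [zero_pow (by omega), ENNReal.ofReal_zero] at this
        exact this.mono_left nhdsWithin_le_nhds
      have h2 := ENNReal.Tendsto.mul_const h1
        (Or.inr (measure_ball_lt_top (μ := volume) (x := (0 : Vec k)) (r := 1)).ne)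
      have h3 := ENNReal.Tendsto.const_mul h2
        (Or.inr (ENNReal.ofReal_ne_top (r := normalConst S)))
      simpa using h3
    obtain ⟨δ, h, hpos⟩ := ((ht.eventually (gt_mem_nhds hη2)).and self_mem_nhdsWithin).exists
    refine ⟨δ, fun b => ?_, hpos⟩
    rw [Measure.addHaar_closedBall _ _ (le_of_lt hpos)]
    simpa using h
  -- For `u > ε`, dividing by `√(uτ)` puts the set inside a Euclidean ball of radius `δ`; `c₁`
  -- converts between the norms.
  refine ⟨c₁ * δ ^ 2 * ε, by positivity, fun τ hτ b => ?_⟩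
  set A : Set (Vec k) := {θ | mahalanobisSq S (θ - b) ≤ c₁ * δ ^ 2 * ε * τ} with hA
  have hAm : MeasurableSet A := by
    have := continuous_mahalanobisSq (S := S)
    exact measurableSet_le (by fun_prop) measurable_const
  rw [← lintegral_indicator_one hAm,
    lintegral_meanPrior hτ (measurable_one.indicator hAm)]
  calc ∫⁻ u, (∫⁻ z, normalDensity 0 S z * A.indicator 1 (Real.sqrt (u * τ) • z)) ∂localPrior a K ℓ
      ≤ ∫⁻ u, ((Iic ε).indicator (fun _ => N) u + η / 2) ∂localPrior a K ℓ := by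
        refine lintegral_mono_ae ?_
        filter_upwards [ae_pos_localPrior] with u hu
        rcases le_or_gt u ε with hue | hue
        · rw [indicator_of_mem (mem_Iic.2 hue)]
          refine le_add_right (lintegral_mono fun z => ?_)
          exact mul_le_of_le_one_right' (indicator_le_self' (by simp) _)
        · refine le_add_left ?_
          have hs : 0 < Real.sqrt (u * τ) := Real.sqrt_pos.2 (mul_pos hu hτ)
          refine le_trans ?_ (hδ ((Real.sqrt (u * τ))⁻¹ • b)).le
          rw [← lintegral_indicator_const Metric.isClosed_closedBall.measurableSet]
          refine lintegral_mono fun z => ?_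
          by_cases hz : Real.sqrt (u * τ) • z ∈ A
          · have hmem : z ∈ Metric.closedBall ((Real.sqrt (u * τ))⁻¹ • b) δ := by
              have h1 : mahalanobisSq S (Real.sqrt (u * τ) • z - b) ≤ c₁ * δ ^ 2 * ε * τ := hz
              have h2 : Real.sqrt (u * τ) • z - b =
                  Real.sqrt (u * τ) • (z - (Real.sqrt (u * τ))⁻¹ • b) := by
                rw [smul_sub, smul_smul, mul_inv_cancel₀ hs.ne', one_smul]
              rw [h2, mahalanobisSq_smul, Real.sq_sqrt (by positivity)] at h1
              have h3 := (hQ (z - (Real.sqrt (u * τ))⁻¹ • b)).1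
              rw [Metric.mem_closedBall, dist_eq_norm]
              set w := z - (Real.sqrt (u * τ))⁻¹ • b
              have h4 : (u * τ * c₁) * ‖w‖ ^ 2 ≤ (u * τ * c₁) * δ ^ 2 := by
                calc (u * τ * c₁) * ‖w‖ ^ 2 = u * τ * (c₁ * ‖w‖ ^ 2) := by ring
                  _ ≤ u * τ * mahalanobisSq S w := by gcongr
                  _ ≤ c₁ * δ ^ 2 * ε * τ := h1
                  _ ≤ c₁ * δ ^ 2 * u * τ := by gcongr
                  _ = _ := by ring
              exact le_of_sq_le_sq (le_of_mul_le_mul_left h4 (by positivity)) hδ0.le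
            rw [indicator_of_mem hz, indicator_of_mem hmem, Pi.one_apply, mul_one]
            exact normalDensity_le hS 0 z
          · rw [indicator_of_notMem hz, mul_zero]
            exact zero_le
    _ = N * localPrior a K ℓ (Iic ε) + η / 2 := by
        rw [lintegral_add_right _ measurable_const, lintegral_indicator_const measurableSet_Iic]
        simp
    _ ≤ η := by
        calc _ ≤ η / 2 + η / 2 := by gcongr
          _ = η := ENNReal.add_halves η

/-! ### Marginal density and posterior law -/

/-- The marginal density of an observation is bounded below on bounded sets, uniformly
in `τ`. -/
theorem exists_le_lintegral_normalDensity_meanPrior [IsProbabilityMeasure (localPrior a K ℓ)]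
    (hS : S.PosDef) (R : ℝ) : ∃ z₀ : ENNReal, 0 < z₀ ∧ ∀ τ ∈ Ioo (0 : ℝ) 1, ∀ x : Vec k,
      ‖x‖ ≤ R → z₀ ≤ ∫⁻ θ, normalDensity θ S x ∂meanPrior S a K ℓ τ := by
  -- Restricting to `u ≤ U` and `‖z‖ ≤ 1` keeps `θ = √(uτ) z` within `√U` of the origin for every `τ
  -- < 1`, hence the uniformity in `τ`.
  obtain ⟨U, hU⟩ : ∃ U : ℝ, 0 < localPrior a K ℓ (Iic U) := by
    have ht := tendsto_measure_Iic_atTop (localPrior a K ℓ)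
    rw [measure_univ] at ht
    exact (ht.eventually (lt_mem_nhds zero_lt_one)).exists
  obtain ⟨d₁, hd₁, h₁⟩ := exists_le_normalDensity hS 1
  obtain ⟨d₂, hd₂, h₂⟩ := exists_le_normalDensity hS (R + Real.sqrt U)
  set B : Set (Vec k) := Metric.closedBall 0 1
  have hBm : MeasurableSet B := Metric.isClosed_closedBall.measurableSet
  refine ⟨d₁ * d₂ * volume B * localPrior a K ℓ (Iic U),
    ENNReal.mul_pos (mul_ne_zero (mul_ne_zero hd₁.ne' hd₂.ne')
      (Metric.measure_closedBall_pos _ _ one_pos).ne') hU.ne', fun τ hτ x hx => ?_⟩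
  rw [lintegral_meanPrior hτ.1 (measurable_normalDensity_mean x),
    ← lintegral_indicator_const measurableSet_Iic]
  refine lintegral_mono_ae ?_
  filter_upwards [ae_pos_localPrior] with u hu
  by_cases huU : u ∈ Iic U
  · rw [indicator_of_mem huU, ← lintegral_indicator_const hBm]
    refine lintegral_mono fun z => ?_
    by_cases hz : z ∈ B
    · rw [indicator_of_mem hz]
      have hz1 : ‖z‖ ≤ 1 := mem_closedBall_zero_iff.1 hz
      refine mul_le_mul' (h₁ 0 z (by simpa using hz1)) (h₂ _ x ?_)
      refine (norm_sub_le _ _).trans (add_le_add hx ?_)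
      rw [norm_smul, Real.norm_of_nonneg (Real.sqrt_nonneg _)]
      refine (mul_le_of_le_one_right (Real.sqrt_nonneg _) hz1).trans (Real.sqrt_le_sqrt ?_)
      have huU' : u ≤ U := huU
      nlinarith [hτ.1, hτ.2]
    · rw [indicator_of_notMem hz]
      exact zero_le
  · rw [indicator_of_notMem huU]
    exact zero_le

theorem lintegral_normalDensity_meanPrior_lt_top [IsFiniteMeasure (localPrior a K ℓ)]
    (hS : S.PosDef) (hτ : 0 < τ) (x : Vec k) :
    ∫⁻ θ, normalDensity θ S x ∂meanPrior S a K ℓ τ < ⊤ := by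
  have := isFiniteMeasure_meanPrior (a := a) (K := K) (ℓ := ℓ) hS hτ
  calc ∫⁻ θ, normalDensity θ S x ∂meanPrior S a K ℓ τ
      ≤ ∫⁻ _, ENNReal.ofReal (normalConst S) ∂meanPrior S a K ℓ τ :=
        lintegral_mono fun θ => normalDensity_le hS θ x
    _ < ⊤ := by
        rw [lintegral_const]
        exact ENNReal.mul_lt_top ENNReal.ofReal_lt_top (measure_lt_top _ _)

theorem isProbabilityMeasure_posteriorLaw [IsProbabilityMeasure (localPrior a K ℓ)]
    (hS : S.PosDef) (hτ : τ ∈ Ioo (0 : ℝ) 1) (x : Vec k) :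
    IsProbabilityMeasure (posteriorLaw S a K ℓ τ x) := by
  obtain ⟨z₀, hz₀, h⟩ := exists_le_lintegral_normalDensity_meanPrior
    (a := a) (K := K) (ℓ := ℓ) hS ‖x‖
  refine ⟨?_⟩
  rw [posteriorLaw, Measure.smul_apply, withDensity_apply _ MeasurableSet.univ, smul_eq_mul,
    setLIntegral_univ]
  exact ENNReal.inv_mul_cancel (hz₀.trans_le (h τ hτ x le_rfl)).ne'
    (lintegral_normalDensity_meanPrior_lt_top hS hτ.1 x).ne

/-- Serves twice: it makes the set defining the posterior quantile nonempty, and it supplies the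
radius `R` of the observation ball. -/
theorem exists_le_measureReal_setOf_le_natCast {Ω : Type*} [MeasurableSpace Ω] (μ : Measure Ω)
    [IsProbabilityMeasure μ] (f : Ω → ℝ) {p : ℝ} (hp : p < 1) :
    ∃ n : ℕ, p ≤ μ.real {x | f x ≤ n} := by
  have hmono : Monotone fun n : ℕ => {x | f x ≤ n} := by
    intro i j hij x hx
    exact le_trans (b := (i : ℝ)) hx (Nat.cast_le.2 hij)
  have huniv : (⋃ n : ℕ, {x | f x ≤ n}) = univ :=
    eq_univ_of_forall fun x => mem_iUnion.2 ⟨_, Nat.le_ceil (f x)⟩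
  have ht := tendsto_measure_iUnion_atTop (μ := μ) hmono
  rw [huniv, measure_univ] at ht
  have ht' := (ENNReal.tendsto_toReal ENNReal.one_ne_top).comp ht
  rw [ENNReal.toReal_one] at ht'
  obtain ⟨n, hn⟩ := (ht'.eventually (lt_mem_nhds hp)).exists
  exact ⟨n, hn.le⟩

/-! ### Posterior radius and posterior mean -/

/-- The posterior quantile of the squared distance is at least of the order `τ`, uniformly over
bounded observations. -/
theorem exists_le_credibleRadius [IsProbabilityMeasure (localPrior a K ℓ)] (hk : 1 ≤ k)
    (hS : S.PosDef) {α : ℝ} (hα0 : 0 < α) (hα1 : α < 1) (R : ℝ) : ∃ c : ℝ, 0 < c ∧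
      ∀ τ ∈ Ioo (0 : ℝ) 1, ∀ x : Vec k, ‖x‖ ≤ R → c * τ ≤ credibleRadius S a K ℓ τ α x := by
  obtain ⟨z₀, hz₀, hz⟩ := exists_le_lintegral_normalDensity_meanPrior
    (a := a) (K := K) (ℓ := ℓ) hS R
  set κ := ENNReal.ofReal (normalConst S) with hκ
  have hκ0 : κ ≠ 0 := (ENNReal.ofReal_pos.2 (normalConst_pos hS)).ne'
  have hκt : κ ≠ ⊤ := ENNReal.ofReal_ne_top
  have ht0 : 0 < ENNReal.ofReal ((1 - α) / 2) := ENNReal.ofReal_pos.2 (by linarith)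
  -- This `η` is chosen so that multiplying by `κ / z₀`, the bound on the posterior density relative
  -- to the prior, gives `(1 - α) / 2`, strictly below `1 - α`.
  obtain ⟨c, hc, hball⟩ := exists_meanPrior_ball_le (a := a) (K := K) (ℓ := ℓ) hk hS
    (η := κ⁻¹ * (z₀ * ENNReal.ofReal ((1 - α) / 2)))
    (ENNReal.mul_pos (ENNReal.inv_ne_zero.2 hκt) (mul_ne_zero hz₀.ne' ht0.ne'))
  refine ⟨c, hc, fun τ hτ x hx => ?_⟩
  have hprob := isProbabilityMeasure_posteriorLaw (a := a) (K := K) (ℓ := ℓ) hS hτ x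
  have hzt : z₀ ≠ ⊤ :=
    ((hz τ hτ x hx).trans_lt (lintegral_normalDensity_meanPrior_lt_top hS hτ.1 x)).ne
  have hQ := continuous_mahalanobisSq (S := S)
  set b := posteriorMean S a K ℓ τ x with hb
  have hm : ∀ r : ℝ, MeasurableSet {θ | mahalanobisSq S (θ - b) ≤ r} := fun r =>
    measurableSet_le (by fun_prop) measurable_const
  -- Nonemptiness matters: the infimum of the empty set would be `0`.
  refine le_csInf ?_ fun r hr => ?_
  · obtain ⟨n, hn⟩ := exists_le_measureReal_setOf_le_natCast (posteriorLaw S a K ℓ τ x)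
      (fun θ => mahalanobisSq S (θ - b)) (show 1 - α < 1 by linarith)
    exact ⟨n, hn⟩
  · by_contra! hlt
    have h1 : posteriorLaw S a K ℓ τ x {θ | mahalanobisSq S (θ - b) ≤ c * τ} ≤
        ENNReal.ofReal ((1 - α) / 2) := by
      rw [posteriorLaw, Measure.smul_apply, withDensity_apply _ (hm _), smul_eq_mul]
      calc _ ≤ z₀⁻¹ * ∫⁻ _ in {θ | mahalanobisSq S (θ - b) ≤ c * τ}, κ ∂meanPrior S a K ℓ τ :=
            mul_le_mul' (ENNReal.inv_le_inv.2 (hz τ hτ x hx))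
              (lintegral_mono fun θ => normalDensity_le hS θ x)
        _ ≤ z₀⁻¹ * (κ * (κ⁻¹ * (z₀ * ENNReal.ofReal ((1 - α) / 2)))) := by
            rw [setLIntegral_const]
            gcongr
            exact hball τ hτ.1 b
        _ = _ := by
            rw [ENNReal.mul_inv_cancel_left hκ0 hκt, ENNReal.inv_mul_cancel_left hz₀.ne' hzt]
    have h2 : 1 - α ≤ (posteriorLaw S a K ℓ τ x).real {θ | mahalanobisSq S (θ - b) ≤ c * τ} :=
      le_trans hr (measureReal_mono fun θ (hθ : _ ≤ _) => hθ.trans hlt.le)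
    have h3 := ENNReal.toReal_le_of_le_ofReal (by linarith) h1
    rw [measureReal_def] at h2
    linarith

/-- The posterior mean is of the order `τ ^ (a / 2)`, uniformly over bounded observations. -/
theorem exists_norm_posteriorMean_le [IsProbabilityMeasure (localPrior a K ℓ)] {M : ℝ}
    (hS : S.PosDef) (ha0 : 0 < a) (ha1 : a ≤ 1) (hnonneg : ∀ u : ℝ, 0 < u → 0 ≤ ℓ u)
    (hupper : ∀ u : ℝ, 0 < u → ℓ u ≤ M) {R : ℝ} (hR : 0 ≤ R) : ∃ C : ℝ,
      ∀ τ ∈ Ioo (0 : ℝ) 1, ∀ x : Vec k, ‖x‖ ≤ R →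
        ‖posteriorMean S a K ℓ τ x‖ ≤ C * τ ^ (a / 2) := by
  obtain ⟨z₀, hz₀, hz⟩ := exists_le_lintegral_normalDensity_meanPrior
    (a := a) (K := K) (ℓ := ℓ) hS R
  obtain ⟨A, hA, hmom⟩ := exists_lintegral_rpow_meanPrior_eq (K := K) hS ha0 ha1 hnonneg hupper
  obtain ⟨c, D, hc, hD, hdom⟩ := exists_normalDensity_mul_le hS
  -- The prior may have no first moment, so `‖θ‖` is traded for `‖θ‖^a (1 + ‖θ‖)`. The extra factor
  -- is at most `(1 + R)(1 + ‖x - θ‖)`, which the Gaussian likelihood absorbs. The order `a` costs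
  -- only `a/2 < a` moments of the local parameter.
  have hpoint : ∀ x θ : Vec k, ‖x‖ ≤ R →
      normalDensity θ S x * ‖θ‖ₑ ≤ ENNReal.ofReal ((1 + R) * D) * ‖θ‖ₑ ^ a := by
    intro x θ hx
    have h1 : ‖θ‖ ≤ ‖θ‖ ^ a * ((1 + R) * (1 + ‖x - θ‖)) := by
      have h2 : ‖θ‖ ≤ ‖θ‖ ^ a * (1 + ‖θ‖) := by
        have h0 := norm_nonneg θ
        have hp : 0 ≤ ‖θ‖ ^ a := by positivity
        rcases le_total ‖θ‖ 1 with h | h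
        · have := Real.rpow_le_rpow_of_exponent_ge_of_imp h0 h ha1 (fun _ h => absurd h one_ne_zero)
          rw [Real.rpow_one] at this
          nlinarith
        · have := Real.one_le_rpow h ha0.le
          nlinarith
      have h3 : ‖θ‖ ≤ R + ‖x - θ‖ := by
        have := norm_sub_le x (x - θ)
        rw [sub_sub_cancel] at this
        linarith
      refine h2.trans (mul_le_mul_of_nonneg_left ?_ (by positivity))
      nlinarith [norm_nonneg (x - θ)]
    have h4 : normalDensity θ S x * ENNReal.ofReal (1 + ‖x - θ‖) ≤ ENNReal.ofReal D := by
      refine (hdom θ x).trans (ENNReal.ofReal_le_ofReal (mul_le_of_le_one_right hD.le ?_))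
      rw [Real.exp_le_one_iff, neg_mul]
      exact neg_nonpos.2 (by positivity)
    calc normalDensity θ S x * ‖θ‖ₑ
        ≤ normalDensity θ S x *
          ENNReal.ofReal (‖θ‖ ^ a * ((1 + R) * (1 + ‖x - θ‖))) := by
          rw [← ofReal_norm]
          gcongr
      _ = normalDensity θ S x * ENNReal.ofReal (1 + ‖x - θ‖) *
          (ENNReal.ofReal (1 + R) * ‖θ‖ₑ ^ a) := by
          rw [ENNReal.ofReal_mul (by positivity), ENNReal.ofReal_mul (by positivity),
            ← ENNReal.ofReal_rpow_of_nonneg (norm_nonneg _) ha0.le, ofReal_norm]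
          ring
      _ ≤ ENNReal.ofReal D * (ENNReal.ofReal (1 + R) * ‖θ‖ₑ ^ a) := by gcongr
      _ = _ := by
          rw [ENNReal.ofReal_mul (by positivity)]
          ring
  set C := z₀⁻¹ * (ENNReal.ofReal ((1 + R) * D) * A) with hC
  have hCt : C ≠ ⊤ := ENNReal.mul_ne_top (ENNReal.inv_ne_top.2 hz₀.ne')
    (ENNReal.mul_ne_top ENNReal.ofReal_ne_top hA.ne)
  refine ⟨C.toReal, fun τ hτ x hx => ?_⟩
  have hτ0 : 0 < τ := hτ.1
  have hmain : ‖posteriorMean S a K ℓ τ x‖ₑ ≤ C * ENNReal.ofReal (τ ^ (a / 2)) := by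
    -- This bound needs no prior check of integrability.
    calc ‖posteriorMean S a K ℓ τ x‖ₑ ≤ ∫⁻ θ, ‖θ‖ₑ ∂posteriorLaw S a K ℓ τ x :=
          enorm_integral_le_lintegral_enorm _
      _ = (∫⁻ θ, normalDensity θ S x ∂meanPrior S a K ℓ τ)⁻¹ *
          ∫⁻ θ, normalDensity θ S x * ‖θ‖ₑ ∂meanPrior S a K ℓ τ := by
          rw [posteriorLaw, lintegral_smul_measure, smul_eq_mul,
            lintegral_withDensity_eq_lintegral_mul _ (measurable_normalDensity_mean x)
              measurable_enorm]
          rfl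
      _ ≤ z₀⁻¹ * ∫⁻ θ, ENNReal.ofReal ((1 + R) * D) * ‖θ‖ₑ ^ a ∂meanPrior S a K ℓ τ :=
          mul_le_mul' (ENNReal.inv_le_inv.2 (hz τ hτ x hx))
            (lintegral_mono fun θ => hpoint x θ hx)
      _ = C * ENNReal.ofReal (τ ^ (a / 2)) := by
          rw [lintegral_const_mul _ (by fun_prop), hmom τ hτ0, hC]
          ring
  have := ENNReal.toReal_mono (ENNReal.mul_ne_top hCt ENNReal.ofReal_ne_top) hmain
  rwa [toReal_enorm, ENNReal.toReal_mul, ENNReal.toReal_ofReal (by positivity)] at this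

/-! ### Coverage -/

/-- For small `τ`, the credible set covers the origin for all observations in a given ball. -/
theorem eventually_zero_mem_credibleSet [IsProbabilityMeasure (localPrior a K ℓ)] {M : ℝ}
    (hk : 1 ≤ k) (hS : S.PosDef) (ha0 : 0 < a) (ha1 : a ≤ 1)
    (hnonneg : ∀ u : ℝ, 0 < u → 0 ≤ ℓ u) (hupper : ∀ u : ℝ, 0 < u → ℓ u ≤ M)
    {α ρ L : ℝ} (hα0 : 0 < α) (hα1 : α < 1) (hρ : 0 < ρ) (hL : 0 < L) {R : ℝ} (hR : 0 ≤ R) :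
    ∀ᶠ τ in 𝓝[>] (0 : ℝ), ∀ x : Vec k, ‖x‖ ≤ R → 0 ∈ credibleSet S a K ℓ τ α ρ L x := by
  obtain ⟨c₁, C₁, -, hC₁, hQ⟩ := exists_norm_sq_equiv hS
  obtain ⟨c, hc, hrad⟩ := exists_le_credibleRadius (a := a) (K := K) (ℓ := ℓ) hk hS hα0 hα1 R
  obtain ⟨C, hmean⟩ := exists_norm_posteriorMean_le (K := K) hS ha0 ha1 hnonneg hupper hR
  set s := a / (1 + ρ) with hs
  have hs0 : 0 < s := by positivity
  have hsa : s < a := div_lt_self ha0 (by linarith)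
  -- The ratio of the squared posterior mean, `O(τ^a)`, to the scale `τ^s` of the inflated radius;
  -- it vanishes because `s < a`.
  have hlim : Tendsto (fun τ : ℝ => C₁ * C ^ 2 * τ ^ (a - s)) (𝓝[>] 0) (𝓝 0) := by
    have h := (Real.continuousAt_rpow_const 0 (a - s) (Or.inr (by linarith))).tendsto
    rw [Real.zero_rpow (by linarith)] at h
    simpa using (h.mono_left nhdsWithin_le_nhds).const_mul (C₁ * C ^ 2)
  have hpos : 0 < L * c ^ s := by positivity
  filter_upwards [hlim.eventually (gt_mem_nhds hpos), Ioo_mem_nhdsGT one_pos] with τ hlt hτ x hx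
  have hτ0 : 0 < τ := hτ.1
  change mahalanobisSq S (0 - posteriorMean S a K ℓ τ x) ≤
    L * credibleRadius S a K ℓ τ α x ^ s
  rw [zero_sub, mahalanobisSq_neg]
  calc mahalanobisSq S (posteriorMean S a K ℓ τ x)
      ≤ C₁ * ‖posteriorMean S a K ℓ τ x‖ ^ 2 := (hQ _).2
    _ ≤ C₁ * (C * τ ^ (a / 2)) ^ 2 := by gcongr; exact hmean τ hτ x hx
    _ = C₁ * C ^ 2 * τ ^ (a - s) * τ ^ s := by
        rw [mul_pow, ← Real.rpow_natCast (τ ^ (a / 2)), ← Real.rpow_mul hτ0.le, mul_assoc _ _ (τ ^ s),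
          ← Real.rpow_add hτ0]
        norm_num
        ring
    _ ≤ L * c ^ s * τ ^ s := by gcongr
    _ = L * (c * τ) ^ s := by rw [Real.mul_rpow hc.le hτ0.le]; ring
    _ ≤ L * credibleRadius S a K ℓ τ α x ^ s := by gcongr; exact hrad τ hτ x hx

theorem chiSquareQuantile_nonneg (k : ℕ) (p : ℝ) : 0 ≤ chiSquareQuantile k p :=
  Real.sInf_nonneg fun _ h => h.1

end GlobalLocal

theorem mainTheorem8
    (k : ℕ) (hk : 1 ≤ k)
    (S : Matrix (Fin k) (Fin k) ℝ) (hS : S.PosDef)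
    -- the prior of the local parameters
    (a K : ℝ) (ha0 : 0 < a) (ha1 : a < 1)
    (ℓ : ℝ → ℝ) (hslow : GlobalLocal.IsSlowlyVarying ℓ)
    (hmono : MonotoneOn ℓ (Set.Ioi 0))
    (hnonneg : ∀ u : ℝ, 0 < u → 0 ≤ ℓ u)
    (m M u₀ : ℝ) (hm : 0 < m)
    (hlower : ∀ u : ℝ, u₀ ≤ u → m ≤ ℓ u)
    (hupper : ∀ u : ℝ, 0 < u → ℓ u ≤ M)
    (hprior : MeasureTheory.IsProbabilityMeasure (GlobalLocal.localPrior a K ℓ))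
    -- the tuning parameter
    (τ : ℕ → ℝ) (hτ : ∀ n, τ n ∈ Set.Ioo (0 : ℝ) 1)
    (hτ0 : Filter.Tendsto τ Filter.atTop (nhds 0))
    -- the credible sets
    (α β ρ L : ℝ) (hα : 0 < α) (hαβ : α < β) (hβ : β < 1) (hρ : 0 < ρ)
    (hL : GlobalLocal.chiSquareQuantile k α *
      GlobalLocal.chiSquareQuantile k β ^ (-a / (1 + ρ)) < L)
    (KS : ℝ) (hKS : 0 < KS)
    -- the true means, sparse in the nearly-black sense
    (q : ℕ → ℕ)
    (hq : (fun n => (q n : ℝ)) =o[Filter.atTop] (fun n : ℕ => (n : ℝ)))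
    (θ₀ : (n : ℕ) → Fin n → GlobalLocal.Vec k)
    (hθ₀ : ∀ n, θ₀ n ∈ GlobalLocal.nearlyBlack k n (q n)) :
    ∃ B : (n : ℕ) → Finset (Fin n),
      (fun n => ((B n).card : ℝ)) =o[Filter.atTop] (fun n : ℕ => (n : ℝ)) ∧
      (∀ n, ∀ i ∉ B n, θ₀ n i = 0 ∧ θ₀ n i ∈ GlobalLocal.smallMeans S KS (τ n)) ∧
      ∀ᶠ n in Filter.atTop, ∀ i ∉ B n,
        1 - α ≤ (GlobalLocal.dataLaw S (θ₀ n)).real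
          {X | θ₀ n i ∈ GlobalLocal.credibleSet S a K ℓ (τ n) α ρ L (X i)} := by
  have hα1 : α < 1 := hαβ.trans hβ
  -- The comparison for small `τ` needs only positivity of `L`, which follows from nonnegativity of
  -- the quantiles.
  have hL0 : 0 < L := lt_of_le_of_lt (mul_nonneg (GlobalLocal.chiSquareQuantile_nonneg k α)
    (Real.rpow_nonneg (GlobalLocal.chiSquareQuantile_nonneg k β) _)) hL
  obtain ⟨R, hcov⟩ := GlobalLocal.exists_le_measureReal_setOf_le_natCast
    (multivariateGaussian (0 : GlobalLocal.Vec k) S) norm (show 1 - α < 1 by linarith)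
  have hev := GlobalLocal.eventually_zero_mem_credibleSet (K := K) hk hS ha0 ha1.le hnonneg hupper
    hα hα1 hρ hL0 R.cast_nonneg
  have hτ' : Tendsto τ atTop (𝓝[>] 0) :=
    tendsto_nhdsWithin_iff.2 ⟨hτ0, Eventually.of_forall fun n => (hτ n).1⟩
  classical
  refine ⟨fun n => {i | θ₀ n i ≠ 0}.toFinset, ?_, fun n i hi => ?_, ?_⟩
  · refine Asymptotics.IsBigO.trans_isLittleO (Asymptotics.IsBigO.of_bound 1 ?_) hq
    refine Eventually.of_forall fun n => ?_
    rw [one_mul, Real.norm_natCast, Real.norm_natCast, Nat.cast_le, ← Set.ncard_eq_toFinset_card']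
    exact hθ₀ n
  · have h0 : θ₀ n i = 0 := by simpa using hi
    refine ⟨h0, ?_⟩
    rw [h0]
    change GlobalLocal.mahalanobisSq S 0 ≤ KS * τ n
    rw [GlobalLocal.mahalanobisSq_zero]
    exact (mul_pos hKS (hτ n).1).le
  · filter_upwards [hτ'.eventually hev] with n hn i hi
    have h0 : θ₀ n i = 0 := by simpa using hi
    have hmp : MeasurePreserving (Function.eval i) (GlobalLocal.dataLaw S (θ₀ n))
        (multivariateGaussian (θ₀ n i) S) :=
      measurePreserving_eval (fun j => multivariateGaussian (θ₀ n j) S) i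
    have hprob : IsProbabilityMeasure (GlobalLocal.dataLaw S (θ₀ n)) := by
      unfold GlobalLocal.dataLaw
      infer_instance
    have hball : MeasurableSet {x : GlobalLocal.Vec k | ‖x‖ ≤ R} :=
      measurableSet_le measurable_norm measurable_const
    rw [h0] at hmp ⊢
    calc 1 - α ≤ (multivariateGaussian (0 : GlobalLocal.Vec k) S).real {x | ‖x‖ ≤ R} := hcov
      _ = (GlobalLocal.dataLaw S (θ₀ n)).real (Function.eval i ⁻¹' {x | ‖x‖ ≤ R}) :=
          (hmp.measureReal_preimage hball.nullMeasurableSet).symm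
      -- Monotonicity alone gives the bound, so measurability of the coverage event is not needed.
      _ ≤ _ := measureReal_mono fun X hX => hn (X i) hX
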